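/- Let $\mathcal H$ be a real Hilbert space. Let $A\colon\mathcal H\rightrightarrows\mathcal H$ be maximally monotone and $\gamma_A$-strongly monotone with $\gamma_A\ge 0$, i.e. $\langle x-y,u-v\rangle\ge\gamma_A\|x-y\|^2$ whenever $u\in Ax$, $v\in Ay$. Let $B\colon\mathcal H\to\mathcal H$ be $\beta$-cocoercive with $\beta>0$, i.e. $\langle x-y,Bx-By\rangle\ge\beta\|Bx-By\|^2$ for all $x,y$, and $\gamma_B$-strongly monotone with $\gamma_B\ge 0$. Put $\operatorname{zer}(A+B)=\{x : 0\in Ax+Bx\}$ and assume $\operatorname{zer}(A+B)\neq\emptyset$. For $\tau\ge 0$ let $\mathcal S_\tau(\mathcal H)$ be the set of bounded self-adjoint operators $U$ on $\mathcal H$ with $U\succeq\tau I$ (that is, $\langle Ux,x\rangle\ge\tau\|x\|^2$ for all $x$). For $M\in\mathcal S_\sigma(\mathcal H)$ with $\sigma>0$, write $\|x\|_M=\sqrt{\langle Mx,x\rangle}$ and $J_A^M=(I+M^{-1}A)^{-1}$. Assume that $(M_k)_{k\in\mathbb N}$ is a sequence in $\mathcal S_\sigma(\mathcal H)$ for some $\sigma>0$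 such that $\sup_k\|M_k\|<\infty$; that there are $\eta_k\ge 0$ with $\sum_k\eta_k<\infty$ and $(1+\eta_k)M_k\succeq M_{k+1}$ for all $k$; and that, for some $\epsilon>0$, $M_k-\tfrac1{2\beta}I\in\mathcal S_\epsilon(\mathcal H)$ for all $k$. Let $(\epsilon_k)_{k\in\mathbb N}$ be a sequence in $\mathcal H$ with $\sum_k\|\epsilon_k\|<\infty$, and let $\alpha_k\in(0,\Lambda]$ with $\Lambda<\infty$. Let $z_{-1},z_0\in\mathcal H$ be arbitrary starting points and, for all $k\ge 0$, $$\bar z_k=z_k+\alpha_k(z_k-z_{k-1}),\qquad z_{k+1}=J_A^{M_k}\bigl(\bar z_k-M_k^{-1}B\bar z_k\bigr)+\epsilon_k .$$ Suppose that $$\sum_{k\in\mathbb N}\alpha_k\max\{\|z_k-z_{k-1}\|_{M_k},\ \|z_k-z_{k-1}\|_{M_k}^2\}<\infty .$$ Then $(z_k)_{k\in\mathbb N}$ is bounded and converges weakly to some $z^*\in\operatorname{zer}(A+B)$. If, moreover, $\epsilon_k=0$ for all $k$, $\gamma_A>0$ or $\gamma_B>0$, and, for some $\epsilon>0$, $M_k-\tfrac1\beta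 I\in\mathcal S_\epsilon(\mathcal H)$ for all $k$, then there exist $\xi\in(0,1)$, $\Theta>0$ and $K_0\in\mathbb N$ such that for all $k\ge K_0$ $$\|z_k-z^*\|_{M_k}^2\le(1-\xi)^{k-K_0}\|z_{K_0}-z^*\|_{M_{K_0}}^2+\sum_{i=K_0}^{k-1}\Theta(1-\xi)^{k-i}\alpha_i\max\{\|z_i-z_{i-1}\|_{M_i},\ \|z_i-z_{i-1}\|_{M_i}^2\}.$$ -/

import Mathlib

open Filter Topology
open scoped Pointwise

namespace InertialFB

variable {H : Type*} [NormedAddCommGroup H] [InnerProductSpace ℝ H]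

/-- A set-valued operator `T : H ⇉ H` is `γ`-strongly monotone: `⟪x - y, u - v⟫ ≥ γ ‖x - y‖²`
for all `(x, u)`, `(y, v)` in its graph. For `γ = 0` this is plain monotonicity. -/
def StronglyMonotone (γ : ℝ) (T : H → Set H) : Prop :=
  ∀ x y u v : H, u ∈ T x → v ∈ T y → γ * ‖x - y‖ ^ 2 ≤ inner ℝ (x - y) (u - v)

/-- A set-valued operator is maximally monotone: it is monotone, and every point of `H × H` that is
monotonically related to its whole graph already belongs to the graph. -/
def MaximallyMonotone (T : H → Set H) : Prop :=
  StronglyMonotone 0 T ∧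
    ∀ x u : H, (∀ y v : H, v ∈ T y → 0 ≤ inner ℝ (x - y) (u - v)) → u ∈ T x

/-- A single-valued operator is `β`-cocoercive. -/
def Cocoercive (β : ℝ) (B : H → H) : Prop :=
  ∀ x y : H, β * ‖B x - B y‖ ^ 2 ≤ inner ℝ (x - y) (B x - B y)

/-- A single-valued map regarded as a set-valued operator. -/
def toSetValued (B : H → H) : H → Set H := fun x => {B x}

/-- The sum of two set-valued operators, by Minkowski sums of the values. -/
def opAdd (S T : H → Set H) : H → Set H := fun x => S x + T x

/-- The inverse of a set-valued operator. -/
def opInv (T : H → Set H) : H → Set H := fun y => {x | y ∈ T x}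

/-- The set of zeros of a set-valued operator. -/
def zer (T : H → Set H) : Set H := {x | 0 ∈ T x}

/-- `𝒮_σ(H)`: the bounded self-adjoint operators `U` with `U ⪰ σ Id` (Loewner order). -/
def selfAdjGE [CompleteSpace H] (σ : ℝ) : Set (H →L[ℝ] H) :=
  {U | IsSelfAdjoint U ∧ σ • ContinuousLinearMap.id ℝ H ≤ U}

/-- The norm `‖x‖_M = √⟪M x, x⟫`. -/
noncomputable def metricNorm (M : H →L[ℝ] H) (x : H) : ℝ :=
  Real.sqrt (inner ℝ (M x) x)

/-- The resolvent `J_A^M = (Id + M⁻¹ A)⁻¹` as a set-valued operator. -/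
noncomputable def metricResolvent (M : H →L[ℝ] H) (A : H → Set H) : H → Set H :=
  opInv (opAdd (toSetValued id) fun y => M.inverse '' A y)

/-- The sequence `k ↦ z_{k-1}`, where `zinit` is the starting value `z_{-1}`. -/
def prev (zinit : H) (z : ℕ → H) : ℕ → H
  | 0 => zinit
  | k + 1 => z k

/-- The extrapolated point `z̄_k = z_k + α_k (z_k - z_{k-1})`. -/
def extrapolate (α : ℕ → ℝ) (zinit : H) (z : ℕ → H) (k : ℕ) : H :=
  z k + α k • (z k - prev zinit z k)

/-- `z` is generated by the inertial variable-metric forward-backward iteration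
`z_{k+1} = J_A^{M_k} (z̄_k - M_k⁻¹ B z̄_k) + ε_k`. -/
def IsInertialFB (A : H → Set H) (B : H → H) (M : ℕ → H →L[ℝ] H) (α : ℕ → ℝ) (err : ℕ → H)
    (zinit : H) (z : ℕ → H) : Prop :=
  ∀ k : ℕ, ∃ w ∈ metricResolvent (M k) A
      (extrapolate α zinit z k - (M k).inverse (B (extrapolate α zinit z k))),
    z (k + 1) = w + err k

/-- The inertial perturbation
`α_k max {‖z_k - z_{k-1}‖_{M_k}, ‖z_k - z_{k-1}‖_{M_k}²}`. -/
noncomputable def inertialTerm (M : ℕ → H →L[ℝ] H) (α : ℕ → ℝ) (zinit : H) (z : ℕ → H)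
    (k : ℕ) : ℝ :=
  α k * max (metricNorm (M k) (z k - prev zinit z k))
    (metricNorm (M k) (z k - prev zinit z k) ^ 2)

end InertialFB

/-! The iteration is quasi-Fejér monotone with respect to the zeros of `A + B` in the moving metrics
`M k`. Write `p` for the extrapolated point, `w` for its exact forward-backward image and `x` for a
zero. Monotonicity of `A` and cocoercivity of `B` give `‖w - x‖_M² ≤ ‖p - x‖_M²` minus a multiple of
`‖p - w‖²` and a square controlling `‖B p - B x‖` (`step_le_of_half`). Extrapolation, errors and
metric changes cost only summable terms, so the distances to each zero converge, `p - w → 0` and `B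
p → B x` (`fejer_convergence`).

Weak convergence then follows Opial's scheme. Weak cluster points are zeros, by cocoercivity and
maximality (`mem_zer_of_weak_limit`). They coincide because `M k` converges pointwise
(`exists_tendsto_apply`), which lets the two limiting distances be compared (`weak_limit_unique`).
Ultrafilters play the role of subsequences.

For the rate, strong monotonicity makes the step a contraction with a uniform factor `q < 1`
(`exists_step_contraction`). Since `η k → 0`, the factor `(1 + η k) * q` eventually stays below a
constant less than `1`, and the recursion is unrolled. -/

namespace InertialFB

/-! ### Perturbed scalar recursions. -/

section Scalar

/-- A nonnegative sequence that is nonincreasing up to summable multiplicative and additive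
perturbations converges. -/
theorem exists_tendsto_of_le_one_add_mul_add {a η δ : ℕ → ℝ} (ha : ∀ k, 0 ≤ a k)
    (hη : ∀ k, 0 ≤ η k) (hηs : Summable η) (hδ : ∀ k, 0 ≤ δ k) (hδs : Summable δ)
    (h : ∀ k, a (k + 1) ≤ (1 + η k) * a k + δ k) : ∃ l, Tendsto a atTop (𝓝 l) := by
  -- Discrete Gronwall bound, from `∏ (1 + η i) ≤ exp (∑ η i)`. It is needed only to bound `a`,
  -- after which the factor `η k` can be treated as an additive perturbation.
  have key : ∀ k, a k ≤ Real.exp (∑ i ∈ Finset.range k, η i) *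
      (a 0 + ∑ i ∈ Finset.range k, δ i) := by
    intro k
    induction k with
    | zero => simp
    | succ k ih =>
      have hS : 0 ≤ ∑ i ∈ Finset.range k, η i := Finset.sum_nonneg fun i _ => hη i
      have h1 : 1 + η k ≤ Real.exp (η k) := by linarith [Real.add_one_le_exp (η k)]
      have h2 : 1 ≤ Real.exp (∑ i ∈ Finset.range k, η i + η k) :=
        Real.one_le_exp (by linarith [hη k])
      calc a (k + 1) ≤ (1 + η k) * a k + δ k := h k
        _ ≤ Real.exp (η k) * (Real.exp (∑ i ∈ Finset.range k, η i) *
            (a 0 + ∑ i ∈ Finset.range k, δ i)) +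
            Real.exp (∑ i ∈ Finset.range k, η i + η k) * δ k := by
          have h3 : δ k ≤ Real.exp (∑ i ∈ Finset.range k, η i + η k) * δ k :=
            le_mul_of_one_le_left (hδ k) h2
          have h4 := mul_le_mul h1 ih (ha k) (Real.exp_nonneg _)
          linarith
        _ = _ := by
          rw [Finset.sum_range_succ, Finset.sum_range_succ, Real.exp_add]; ring
  obtain ⟨R, hR⟩ : ∃ R, ∀ k, a k ≤ R := by
    refine ⟨Real.exp (∑' i, η i) * (a 0 + ∑' i, δ i), fun k => (key k).trans ?_⟩
    have h1 := hηs.sum_le_tsum (Finset.range k) fun i _ => hη i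
    have h2 := hδs.sum_le_tsum (Finset.range k) fun i _ => hδ i
    have h3 : 0 ≤ a 0 + ∑ i ∈ Finset.range k, δ i :=
      add_nonneg (ha 0) (Finset.sum_nonneg fun i _ => hδ i)
    gcongr
  have hsum : Summable fun k => η k * R + δ k := (hηs.mul_right R).add hδs
  have hanti : Antitone fun k => a k - ∑ i ∈ Finset.range k, (η i * R + δ i) := by
    refine antitone_nat_of_succ_le fun k => ?_
    rw [Finset.sum_range_succ]
    have := mul_le_mul_of_nonneg_left (hR k) (hη k)
    linarith [h k]
  have hR0 : 0 ≤ R := (ha 0).trans (hR 0)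
  have hbdd : BddBelow (Set.range fun k => a k - ∑ i ∈ Finset.range k, (η i * R + δ i)) := by
    refine ⟨-∑' i, (η i * R + δ i), ?_⟩
    rintro _ ⟨k, rfl⟩
    have := hsum.sum_le_tsum (Finset.range k) fun i _ => add_nonneg (mul_nonneg (hη i) hR0) (hδ i)
    linarith [ha k]
  refine ⟨_, ((tendsto_atTop_ciInf hanti hbdd).add hsum.hasSum.tendsto_sum_nat).congr fun k => ?_⟩
  ring

/-- Unrolling a perturbed linear contraction. -/
theorem le_pow_mul_add_sum {a t : ℕ → ℝ} {r c : ℝ} {K : ℕ} (hr : 0 ≤ r)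
    (h : ∀ k, K ≤ k → a (k + 1) ≤ r * (a k + c * t k)) (k : ℕ) (hk : K ≤ k) :
    a k ≤ r ^ (k - K) * a K + ∑ i ∈ Finset.Ico K k, c * r ^ (k - i) * t i := by
  induction k, hk using Nat.le_induction with
  | base => simp
  | succ k hk ih =>
    rw [Finset.sum_Ico_succ_top hk]
    have h1 : ∑ i ∈ Finset.Ico K k, c * r ^ (k + 1 - i) * t i =
        r * ∑ i ∈ Finset.Ico K k, c * r ^ (k - i) * t i := by
      rw [Finset.mul_sum]
      refine Finset.sum_congr rfl fun i hi => ?_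
      rw [Nat.succ_sub (Finset.mem_Ico.1 hi).2.le, pow_succ]; ring
    -- The new top summand has exponent `k + 1 - k = 1`: the perturbation enters before the
    -- contraction acts, so it too gains a factor `r`.
    rw [h1, Nat.succ_sub hk, pow_succ, Nat.add_sub_cancel_left, pow_one]
    have := mul_le_mul_of_nonneg_left ih hr
    linarith [h k hk]

end Scalar

/-! ### Positive operators, their norms and monotone limits. -/

section Operators

variable {H : Type*} [NormedAddCommGroup H] [InnerProductSpace ℝ H]

theorem inner_apply_le_of_le {M N : H →L[ℝ] H} (h : N ≤ M) (x : H) :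
    inner ℝ (N x) x ≤ inner ℝ (M x) x := by
  have := ((ContinuousLinearMap.le_def N M).1 h).inner_nonneg_left x
  simpa [inner_sub_left] using this

theorem inner_apply_comm {M : H →L[ℝ] H} (hM : M.IsPositive) (x y : H) :
    inner ℝ (M x) y = inner ℝ (M y) x := by
  rw [hM.inner_left_eq_inner_right, real_inner_comm]

/-- Cauchy–Schwarz for a possibly degenerate form: the quadratic `t ↦ ⟪M (x + t y), x + t y⟫` is
nonnegative, so its discriminant is nonpositive. -/
theorem sq_inner_apply_le {M : H →L[ℝ] H} (hM : M.IsPositive) (x y : H) :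
    inner ℝ (M x) y ^ 2 ≤ inner ℝ (M x) x * inner ℝ (M y) y := by
  have h : ∀ t : ℝ, 0 ≤ inner ℝ (M y) y * (t * t) + 2 * inner ℝ (M x) y * t +
      inner ℝ (M x) x := by
    intro t
    have h1 := hM.inner_nonneg_left (x + t • y)
    have h2 : inner ℝ (M (x + t • y)) (x + t • y) = inner ℝ (M y) y * (t * t) +
        2 * inner ℝ (M x) y * t + inner ℝ (M x) x := by
      simp only [map_add, map_smul, inner_add_left, inner_add_right, real_inner_smul_left,
        real_inner_smul_right, inner_apply_comm hM y x]
      ring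
    rwa [h2] at h1
  have := discrim_le_zero h
  rw [discrim] at this
  linarith

/-- Cauchy–Schwarz with `y = M x`. This upgrades convergence of quadratic forms to strong
convergence in `exists_tendsto_apply`. -/
theorem norm_apply_sq_le {M : H →L[ℝ] H} (hM : M.IsPositive) (x : H) :
    ‖M x‖ ^ 2 ≤ ‖M‖ * inner ℝ (M x) x := by
  have h1 := sq_inner_apply_le hM x (M x)
  have h2 : inner ℝ (M (M x)) (M x) ≤ ‖M‖ * ‖M x‖ ^ 2 := by
    refine (real_inner_le_norm _ _).trans ?_
    have := mul_le_mul_of_nonneg_right (M.le_opNorm (M x)) (norm_nonneg (M x))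
    linarith
  rw [real_inner_self_eq_norm_sq] at h1
  have h0 := hM.inner_nonneg_left x
  rcases eq_or_ne (M x) 0 with h | h
  · simp [h]
  · have hp : 0 < ‖M x‖ ^ 2 := by positivity
    have h3 := mul_le_mul_of_nonneg_left h2 h0
    refine le_of_mul_le_mul_right ?_ hp
    linarith

theorem inner_apply_self_le (M : H →L[ℝ] H) {C : ℝ} (hC : ‖M‖ ≤ C) (x : H) :
    inner ℝ (M x) x ≤ C * ‖x‖ ^ 2 := by
  refine (real_inner_le_norm _ _).trans ?_
  have := mul_le_mul_of_nonneg_right (M.le_of_opNorm_le hC x) (norm_nonneg x)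
  linarith

theorem metricNorm_nonneg (M : H →L[ℝ] H) (x : H) : 0 ≤ metricNorm M x := Real.sqrt_nonneg _

theorem metricNorm_sq {M : H →L[ℝ] H} (hM : M.IsPositive) (x : H) :
    metricNorm M x ^ 2 = inner ℝ (M x) x := Real.sq_sqrt (hM.inner_nonneg_left x)

theorem metricNorm_add_le {M : H →L[ℝ] H} (hM : M.IsPositive) (x y : H) :
    metricNorm M (x + y) ≤ metricNorm M x + metricNorm M y := by
  have hx := metricNorm_nonneg M x
  have hy := metricNorm_nonneg M y
  refine abs_le_of_sq_le_sq' ?_ (add_nonneg hx hy) |>.2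
  have h1 : inner ℝ (M x) y ≤ metricNorm M x * metricNorm M y := by
    refine abs_le_of_sq_le_sq' ?_ (mul_nonneg hx hy) |>.2
    rw [mul_pow, metricNorm_sq hM, metricNorm_sq hM]
    exact sq_inner_apply_le hM x y
  rw [add_sq, metricNorm_sq hM, metricNorm_sq hM, metricNorm_sq hM]
  simp only [map_add, inner_add_left, inner_add_right, inner_apply_comm hM y x]
  linarith

theorem metricNorm_smul {M : H →L[ℝ] H} {c : ℝ} (hc : 0 ≤ c) (x : H) :
    metricNorm M (c • x) = c * metricNorm M x := by
  simp only [metricNorm, map_smul, real_inner_smul_left, real_inner_smul_right]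
  rw [← mul_assoc, Real.sqrt_mul (mul_nonneg hc hc), Real.sqrt_mul_self hc]

theorem metricNorm_le {M : H →L[ℝ] H} {C : ℝ} (hC : ‖M‖ ≤ C) (x : H) :
    metricNorm M x ≤ √C * ‖x‖ := by
  have h := Real.sqrt_le_sqrt (inner_apply_self_le M hC x)
  rwa [Real.sqrt_mul ((norm_nonneg M).trans hC), Real.sqrt_sq (norm_nonneg x)] at h

theorem sqrt_mul_norm_le_metricNorm {M : H →L[ℝ] H} {σ : ℝ} (hσ : 0 ≤ σ)
    (h : ∀ x, σ * ‖x‖ ^ 2 ≤ inner ℝ (M x) x) (x : H) : √σ * ‖x‖ ≤ metricNorm M x := by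
  have h := Real.sqrt_le_sqrt (h x)
  rwa [Real.sqrt_mul hσ, Real.sqrt_sq (norm_nonneg x)] at h

/-- The natural factor is `√(1 + η)`; the cruder `1 + η` keeps the recursion free of roots and is
equally summable. -/
theorem metricNorm_le_one_add_mul {M N : H →L[ℝ] H} (hM : M.IsPositive) {η : ℝ} (hη : 0 ≤ η)
    (h : N ≤ (1 + η) • M) (x : H) : metricNorm N x ≤ (1 + η) * metricNorm M x := by
  have h1 := inner_apply_le_of_le h x
  rw [smul_apply, real_inner_smul_left] at h1
  refine Real.sqrt_le_iff.2 ⟨mul_nonneg (by linarith) (metricNorm_nonneg M x), h1.trans ?_⟩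
  rw [mul_pow, metricNorm_sq hM]
  refine mul_le_mul_of_nonneg_right ?_ (hM.inner_nonneg_left x)
  nlinarith

/-- Membership in the metric resolvent, in terms of the inverse metric step. -/
theorem sub_mem_of_mem_metricResolvent {M : H →L[ℝ] H} (hM : M.IsInvertible) {A : H → Set H}
    {p b w : H} (h : w ∈ metricResolvent M A (p - M.inverse b)) : M (p - w) - b ∈ A w := by
  obtain ⟨_, rfl, _, ⟨u, hu, rfl⟩, he⟩ := h
  obtain ⟨e, rfl⟩ := hM
  simp only [ContinuousLinearMap.inverse_equiv, ContinuousLinearEquiv.coe_coe] at he hu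
  rw [eq_comm, sub_eq_iff_eq_add] at he
  convert hu using 1
  rw [he, ContinuousLinearEquiv.coe_coe, add_assoc, add_sub_cancel_left, map_add]
  simp

variable [CompleteSpace H]

theorem le_inner_apply_of_mem {M : H →L[ℝ] H} {σ : ℝ} (h : M ∈ selfAdjGE σ) (x : H) :
    σ * ‖x‖ ^ 2 ≤ inner ℝ (M x) x := by
  have := inner_apply_le_of_le h.2 x
  simpa [real_inner_smul_left] using this

theorem add_mul_le_inner_apply_of_sub_mem {M : H →L[ℝ] H} {c ε : ℝ}
    (h : M - c • ContinuousLinearMap.id ℝ H ∈ selfAdjGE ε) (x : H) :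
    (c + ε) * ‖x‖ ^ 2 ≤ inner ℝ (M x) x := by
  have := le_inner_apply_of_mem h x
  simp only [sub_apply, smul_apply, ContinuousLinearMap.id_apply, inner_sub_left,
    real_inner_smul_left, real_inner_self_eq_norm_sq] at this
  linarith

theorem isPositive_of_mem {M : H →L[ℝ] H} {σ : ℝ} (hσ : 0 ≤ σ) (h : M ∈ selfAdjGE σ) :
    M.IsPositive := by
  rw [← sub_zero M, ← ContinuousLinearMap.le_def]
  refine le_trans ?_ h.2
  rw [ContinuousLinearMap.le_def, sub_zero]
  exact ContinuousLinearMap.isPositive_id.smul_of_nonneg hσ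

/-- Lax–Milgram: the form `⟪M x, y⟫` is coercive. -/
theorem isInvertible_of_mem {M : H →L[ℝ] H} {σ : ℝ} (hσ : 0 < σ) (h : M ∈ selfAdjGE σ) :
    M.IsInvertible := by
  have hco : IsCoercive ((innerSL ℝ).comp M : H →L[ℝ] H →L[ℝ] ℝ) := by
    refine ⟨σ, hσ, fun u => ?_⟩
    have := le_inner_apply_of_mem h u
    simpa [mul_assoc, sq] using this
  refine ⟨hco.continuousLinearEquivOfBilin, ?_⟩
  ext x
  refine ext_inner_right ℝ fun y => ?_
  simp

/-- A bounded sequence of positive operators that is decreasing up to summable factors converges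
pointwise. -/
theorem exists_tendsto_apply {M : ℕ → H →L[ℝ] H} (hM : ∀ k, (M k).IsPositive) {C : ℝ}
    (hC : ∀ k, ‖M k‖ ≤ C) {η : ℕ → ℝ} (hη : ∀ k, 0 ≤ η k) (hηs : Summable η)
    (hle : ∀ k, M (k + 1) ≤ (1 + η k) • M k) (x : H) : ∃ y, Tendsto (M · x) atTop (𝓝 y) := by
  have hC0 : 0 ≤ C := (norm_nonneg _).trans (hC 0)
  set S : ℕ → ℝ := fun k => ∑ i ∈ Finset.range k, η i with hS
  have hST : ∀ k, S k ≤ ∑' i, η i := fun k => hηs.sum_le_tsum _ fun i _ => hη i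
  have hS0 : ∀ k, 0 ≤ S k := fun k => Finset.sum_nonneg fun i _ => hη i
  -- Subtracting `C * S k` makes the sequence decreasing in the Loewner order, because `η k • M k ≤
  -- (η k * C) • Id`.
  set L : ℕ → H →L[ℝ] H := fun k => M k - (C * S k) • ContinuousLinearMap.id ℝ H with hL
  have hsym : ∀ k, (L k).IsSymmetric := fun k a b => by
    have := (hM k).isSymmetric a b
    simp only [ContinuousLinearMap.coe_coe] at this
    simp [hL, inner_sub_left, inner_sub_right, real_inner_smul_left, real_inner_smul_right, this]
  have hLa : ∀ k y, inner ℝ (L k y) y = inner ℝ (M k y) y - C * S k * ‖y‖ ^ 2 := fun k y => by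
    simp [hL, inner_sub_left, real_inner_smul_left]
  have hanti : ∀ y, Antitone fun k => inner ℝ (L k y) y := fun y => by
    refine antitone_nat_of_succ_le fun k => ?_
    have h1 := inner_apply_le_of_le (hle k) y
    rw [smul_apply, real_inner_smul_left] at h1
    have h2 := mul_le_mul_of_nonneg_left (inner_apply_self_le (M k) (hC k) y) (hη k)
    have h3 : S (k + 1) = S k + η k := Finset.sum_range_succ _ _
    rw [hLa, hLa, h3]
    nlinarith
  have hpos : ∀ m n, m ≤ n → (L m - L n).IsPositive := fun m n hmn => by
    refine ContinuousLinearMap.isPositive_def.2 ⟨?_, fun y => ?_⟩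
    · exact fun a b => by
        have h1 := hsym m a b
        have h2 := hsym n a b
        simp only [ContinuousLinearMap.coe_coe] at h1 h2
        simp [inner_sub_left, inner_sub_right, h1, h2]
    · have := hanti y hmn
      simp only [ContinuousLinearMap.reApplyInnerSelf_apply, sub_apply,
        inner_sub_left, RCLike.re_to_real]
      linarith
  set T := C + C * ∑' i, η i with hT
  have hLn : ∀ k, ‖L k‖ ≤ T := fun k => by
    refine (norm_sub_le _ _).trans (add_le_add (hC k) ?_)
    rw [norm_smul, Real.norm_of_nonneg (mul_nonneg hC0 (hS0 k))]
    refine (mul_le_of_le_one_right (mul_nonneg hC0 (hS0 k)) ContinuousLinearMap.norm_id_le).trans ?_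
    exact mul_le_mul_of_nonneg_left (hST k) hC0
  have hbdd : BddBelow (Set.range fun k => inner ℝ (L k x) x) := by
    refine ⟨-(C * (∑' i, η i) * ‖x‖ ^ 2), ?_⟩
    rintro _ ⟨k, rfl⟩
    have h1 := (hM k).inner_nonneg_left x
    have h2 := mul_le_mul_of_nonneg_right (mul_le_mul_of_nonneg_left (hST k) hC0) (sq_nonneg ‖x‖)
    simp only [hLa]
    linarith
  have hcs : CauchySeq fun k => inner ℝ (L k x) x :=
    (tendsto_atTop_ciInf (hanti x) hbdd).cauchySeq
  have hT0 : 0 ≤ T := (norm_nonneg _).trans (hLn 0)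
  have hLc : CauchySeq fun k => L k x := by
    rw [Metric.cauchySeq_iff'] at hcs ⊢
    intro ε hε
    -- `‖(L N - L n) x‖²` is at most `2 * T` times the drop of the quadratic form; the `+ 1` covers
    -- `T = 0`.
    obtain ⟨N, hN⟩ := hcs (ε ^ 2 / (2 * T + 1)) (by positivity)
    refine ⟨N, fun n hn => ?_⟩
    have h1 := norm_apply_sq_le (hpos N n hn) x
    have h2 : ‖L N - L n‖ ≤ 2 * T := (norm_sub_le _ _).trans (by linarith [hLn N, hLn n])
    have h3 := hN n hn
    rw [Real.dist_eq, abs_sub_comm] at h3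
    have h4 : inner ℝ ((L N - L n) x) x < ε ^ 2 / (2 * T + 1) := by
      rw [sub_apply, inner_sub_left]
      exact (le_abs_self _).trans_lt h3
    have h5 := (hpos N n hn).inner_nonneg_left x
    rw [lt_div_iff₀ (by positivity)] at h4
    rw [dist_comm, dist_eq_norm]
    refine abs_lt_of_sq_lt_sq' ?_ hε.le |>.2
    have h6 := mul_le_mul_of_nonneg_right h2 h5
    rw [← sub_apply]
    linarith
  obtain ⟨y, hy⟩ := cauchySeq_tendsto_of_complete hLc
  have hSl : Tendsto S atTop (𝓝 (∑' i, η i)) := hηs.hasSum.tendsto_sum_nat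
  refine ⟨_, (hy.add ((hSl.const_mul C).smul_const x)).congr fun k => ?_⟩
  simp [hL]

end Operators

/-! ### Weak convergence along filters. -/

section Weak

variable {H : Type*} [NormedAddCommGroup H] [InnerProductSpace ℝ H]

theorem tendsto_inner_of_weak_of_strong {ι : Type*} {l : Filter ι} {f g : ι → H} {x y : H} {R : ℝ}
    (hR : ∀ i, ‖f i‖ ≤ R) (hf : ∀ h, Tendsto (fun i => inner ℝ (f i) h) l (𝓝 (inner ℝ x h)))
    (hg : Tendsto g l (𝓝 y)) : Tendsto (fun i => inner ℝ (f i) (g i)) l (𝓝 (inner ℝ x y)) := by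
  have h0 : Tendsto (fun i => inner ℝ (f i) (g i - y)) l (𝓝 0) := by
    refine squeeze_zero_norm (a := fun i => R * ‖g i - y‖) (fun i => ?_) ?_
    · refine (norm_inner_le_norm _ _).trans ?_
      gcongr
      exact hR i
    · simpa using ((tendsto_iff_norm_sub_tendsto_zero.1 hg).const_mul R)
  have := (hf y).add h0
  rw [add_zero] at this
  refine this.congr fun i => ?_
  rw [inner_sub_right]; ring

theorem weak_limit_of_tendsto_sub {ι : Type*} {l : Filter ι} {f g : ι → H} {x : H}
    (hf : ∀ h, Tendsto (fun i => inner ℝ (f i) h) l (𝓝 (inner ℝ x h)))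
    (hg : Tendsto (fun i => g i - f i) l (𝓝 0)) (h : H) :
    Tendsto (fun i => inner ℝ (g i) h) l (𝓝 (inner ℝ x h)) := by
  have := (hf h).add (hg.inner (tendsto_const_nhds (x := h)))
  rw [inner_zero_left, add_zero] at this
  refine this.congr fun i => ?_
  rw [inner_sub_left]; ring

variable [CompleteSpace H]

/-- Bounded families in a Hilbert space converge weakly along ultrafilters. -/
theorem exists_weak_limit {ι : Type*} (U : Ultrafilter ι) {f : ι → H} {R : ℝ}
    (hR : ∀ i, ‖f i‖ ≤ R) :
    ∃ x, ∀ h, Tendsto (fun i => inner ℝ (f i) h) U (𝓝 (inner ℝ x h)) := by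
  have hb : ∀ h i, ‖inner ℝ (f i) h‖ ≤ R * ‖h‖ := fun h i =>
    (norm_inner_le_norm _ _).trans (mul_le_mul_of_nonneg_right (hR i) (norm_nonneg h))
  -- Each scalar family lies in a compact ball, so it converges along the ultrafilter. The limits
  -- form a bounded linear functional, which Riesz represents by a vector.
  have hex : ∀ h, ∃ c, ‖c‖ ≤ R * ‖h‖ ∧ Tendsto (fun i => inner ℝ (f i) h) U (𝓝 c) := by
    intro h
    obtain ⟨c, hc, hle⟩ := (isCompact_closedBall (0 : ℝ) (R * ‖h‖)).ultrafilter_le_nhds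
      (U.map fun i => inner ℝ (f i) h)
      (le_principal_iff.2 (Filter.mem_map.2 (Filter.univ_mem' fun i => by
        simpa [Metric.mem_closedBall, dist_zero_right] using hb h i)))
    exact ⟨c, by simpa using hc, hle⟩
  choose φ hφ hlim using hex
  let ψ : H →ₗ[ℝ] ℝ :=
    { toFun := φ
      map_add' := fun a b => tendsto_nhds_unique (hlim (a + b))
        (((hlim a).add (hlim b)).congr fun i => (inner_add_right _ _ _).symm)
      map_smul' := fun c a => tendsto_nhds_unique (hlim (c • a))
        (((hlim a).const_mul c).congr fun i => (real_inner_smul_right _ _ _).symm) }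
  refine ⟨(InnerProductSpace.toDual ℝ H).symm (ψ.mkContinuous R hφ), fun h => ?_⟩
  rw [InnerProductSpace.toDual_symm_apply]
  exact hlim h

theorem tendsto_toWeakSpace {ι : Type*} {l : Filter ι} {f : ι → H} {x : H}
    (h : ∀ y, Tendsto (fun i => inner ℝ (f i) y) l (𝓝 (inner ℝ x y))) :
    Tendsto (fun i => toWeakSpace ℝ H (f i)) l (𝓝 (toWeakSpace ℝ H x)) := by
  refine (WeakBilin.tendsto_iff_forall_eval_tendsto (topDualPairing ℝ H).flip ?_).2 fun φ => ?_
  · intro a b hab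
    exact ext_inner_left ℝ fun v => LinearMap.congr_fun hab (innerSL ℝ v)
  · have hφ : ∀ v, φ v = inner ℝ v ((InnerProductSpace.toDual ℝ H).symm φ) := fun v => by
      rw [real_inner_comm, InnerProductSpace.toDual_symm_apply]
    change Tendsto (fun i => φ (f i)) l (𝓝 (φ x))
    simp only [hφ]
    exact h _

end Weak

/-! ### One forward-backward step, and Opial-type limit arguments. -/

section Step

variable {H : Type*} [NormedAddCommGroup H]

theorem mem_zer_opAdd {A : H → Set H} {B : H → H} {x : H} :
    x ∈ zer (opAdd A (toSetValued B)) ↔ -B x ∈ A x := by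
  constructor
  · rintro ⟨a, ha, _, rfl, h⟩
    rwa [← eq_neg_of_add_eq_zero_left h]
  · exact fun h => ⟨_, h, _, rfl, neg_add_cancel _⟩

variable [InnerProductSpace ℝ H]

/-- The basic estimate for one forward-backward step, before cocoercivity is used. -/
theorem step_inner_le {A : H → Set H} {B : H → H} {γ : ℝ} (hA : StronglyMonotone γ A)
    {M : H →L[ℝ] H} (hM : M.IsPositive) {p w x : H} (hw : M (p - w) - B p ∈ A w)
    (hx : -B x ∈ A x) :
    inner ℝ (M (w - x)) (w - x) + inner ℝ (M (p - w)) (p - w) + 2 * γ * ‖w - x‖ ^ 2 +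
      2 * (inner ℝ (p - x) (B p - B x) - inner ℝ (p - w) (B p - B x)) ≤
      inner ℝ (M (p - x)) (p - x) := by
  have h := hA w x _ _ hw hx
  have h1 : p - x = (p - w) + (w - x) := by abel
  have h2 : inner ℝ (w - x) (M (p - w) - B p - -B x) =
      inner ℝ (M (p - w)) (w - x) - inner ℝ (w - x) (B p - B x) := by
    rw [show M (p - w) - B p - -B x = M (p - w) - (B p - B x) by abel, inner_sub_right,
      real_inner_comm]
  rw [h2] at h
  rw [h1, map_add, inner_add_left, inner_add_left, inner_add_right, inner_add_right,
    inner_apply_comm hM (w - x) (p - w)]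
  linarith

/-- All of `2⟪p - x, B p - B x⟫` is spent on cocoercivity. Together with the part `1 / (2β)` of the
metric it completes the square; the surplus `ε` controls the residual `p - w`. -/
theorem step_le_of_half {A : H → Set H} {B : H → H} {β : ℝ} (hβ : 0 < β)
    (hA : StronglyMonotone 0 A) (hB : Cocoercive β B) {M : H →L[ℝ] H} (hM : M.IsPositive) {ε : ℝ}
    (hε : ∀ x, (1 / (2 * β) + ε) * ‖x‖ ^ 2 ≤ inner ℝ (M x) x) {p w x : H}
    (hw : M (p - w) - B p ∈ A w) (hx : -B x ∈ A x) :
    inner ℝ (M (w - x)) (w - x) + ε * ‖p - w‖ ^ 2 +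
      2 * β * (‖B p - B x‖ - ‖p - w‖ / (2 * β)) ^ 2 ≤ inner ℝ (M (p - x)) (p - x) := by
  have h := step_inner_le hA hM hw hx
  have h1 := hB p x
  have h2 := real_inner_le_norm (p - w) (B p - B x)
  have h3 := hε (p - w)
  have h4 : 2 * β * (‖B p - B x‖ - ‖p - w‖ / (2 * β)) ^ 2 =
      2 * β * ‖B p - B x‖ ^ 2 - 2 * (‖p - w‖ * ‖B p - B x‖) + 1 / (2 * β) * ‖p - w‖ ^ 2 := by
    field_simp
    ring
  rw [h4]
  linarith

/-- Of the two copies of `⟪p - x, B p - B x⟫`, one is spent on cocoercivity and one on strong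
monotonicity. Having only `β` in place of `2β` is what forces the stronger bound `M ⪰ β⁻¹ Id`. -/
theorem step_le_of_one {A : H → Set H} {B : H → H} {β γA γB : ℝ} (hβ : 0 < β)
    (hA : StronglyMonotone γA A) (hB : Cocoercive β B)
    (hBm : StronglyMonotone γB (toSetValued B)) {M : H →L[ℝ] H} (hM : M.IsPositive)
    (hMβ : ∀ x, 1 / β * ‖x‖ ^ 2 ≤ inner ℝ (M x) x) {p w x : H}
    (hw : M (p - w) - B p ∈ A w) (hx : -B x ∈ A x) :
    inner ℝ (M (w - x)) (w - x) + 2 * γA * ‖w - x‖ ^ 2 + γB * ‖p - x‖ ^ 2 ≤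
      inner ℝ (M (p - x)) (p - x) := by
  have h := step_inner_le hA hM hw hx
  have h1 := hB p x
  have h5 := hBm p x _ _ rfl rfl
  have h2 := real_inner_le_norm (p - w) (B p - B x)
  have h3 := hMβ (p - w)
  have h4 : 0 ≤ β * (‖B p - B x‖ - ‖p - w‖ / β) ^ 2 := by positivity
  have h6 : β * (‖B p - B x‖ - ‖p - w‖ / β) ^ 2 =
      β * ‖B p - B x‖ ^ 2 - 2 * (‖p - w‖ * ‖B p - B x‖) + 1 / β * ‖p - w‖ ^ 2 := by
    field_simp
    ring
  linarith

/-- Under strong monotonicity the forward-backward step contracts the distance to a zero. -/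
theorem exists_step_contraction {A : H → Set H} {B : H → H} {β γA γB : ℝ} (hβ : 0 < β)
    (hγA : 0 ≤ γA) (hγB : 0 ≤ γB) (hγ : 0 < γA ∨ 0 < γB)
    (hA : StronglyMonotone γA A) (hB : Cocoercive β B)
    (hBm : StronglyMonotone γB (toSetValued B)) (C : ℝ) :
    ∃ q, 0 ≤ q ∧ q < 1 ∧ ∀ M : H →L[ℝ] H, M.IsPositive → ‖M‖ ≤ C →
      (∀ x, 1 / β * ‖x‖ ^ 2 ≤ inner ℝ (M x) x) → ∀ p w x : H, M (p - w) - B p ∈ A w → -B x ∈ A x →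
      inner ℝ (M (w - x)) (w - x) ≤ q * inner ℝ (M (p - x)) (p - x) := by
  -- `D ≥ C` gives `‖y‖_M² ≤ D ‖y‖²`, turning the norm terms into metric ones, and `D ≥ γB` keeps `1
  -- - γB / D` nonnegative.
  set D := |C| + γB + 1 with hD
  have hD0 : 0 < D := by positivity
  have hbd : ∀ M : H →L[ℝ] H, ‖M‖ ≤ C → ∀ y, inner ℝ (M y) y / D ≤ ‖y‖ ^ 2 := fun M hM y => by
    rw [div_le_iff₀ hD0, mul_comm]
    refine inner_apply_self_le M (hM.trans ?_) y
    linarith [le_abs_self C]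
  have hq : 0 ≤ 1 - γB / D := by
    rw [sub_nonneg, div_le_one hD0]; linarith [abs_nonneg C]
  have ha : 0 ≤ 2 * γA / D := by positivity
  have ha' : 0 < 1 + 2 * γA / D := by positivity
  refine ⟨(1 - γB / D) / (1 + 2 * γA / D), by positivity, ?_, ?_⟩
  · rw [div_lt_one ha']
    rcases hγ with h | h
    · have : 0 < 2 * γA / D := by positivity
      have : 0 ≤ γB / D := by positivity
      linarith
    · have : 0 < γB / D := by positivity
      linarith
  · intro M hM hMC hMβ p w x hw hx
    have h := step_le_of_one hβ hA hB hBm hM hMβ hw hx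
    have h1 := mul_le_mul_of_nonneg_left (hbd M hMC (w - x)) (by positivity : 0 ≤ 2 * γA)
    have h2 := mul_le_mul_of_nonneg_left (hbd M hMC (p - x)) hγB
    rw [div_mul_eq_mul_div, le_div_iff₀ ha']
    have e1 : inner ℝ (M (w - x)) (w - x) * (1 + 2 * γA / D) =
      inner ℝ (M (w - x)) (w - x) + 2 * γA * (inner ℝ (M (w - x)) (w - x) / D) := by ring
    have e2 : (1 - γB / D) * inner ℝ (M (p - x)) (p - x) =
      inner ℝ (M (p - x)) (p - x) - γB * (inner ℝ (M (p - x)) (p - x) / D) := by ring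
    rw [e1, e2]
    linarith

/-- Weak limits of forward-backward points with vanishing residual are zeros of `A + B`. -/
theorem mem_zer_of_weak_limit {A : H → Set H} {B : H → H} {β : ℝ} (hβ : 0 < β)
    (hA : MaximallyMonotone A) (hB : Cocoercive β B) {ι : Type*} {l : Filter ι} [l.NeBot]
    {w p u : ι → H} {x b : H} {R : ℝ} (hwR : ∀ i, ‖w i‖ ≤ R) (hpR : ∀ i, ‖p i‖ ≤ R)
    (hw : ∀ h, Tendsto (fun i => inner ℝ (w i) h) l (𝓝 (inner ℝ x h)))
    (hp : ∀ h, Tendsto (fun i => inner ℝ (p i) h) l (𝓝 (inner ℝ x h)))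
    (hu : ∀ i, u i ∈ A (w i)) (hub : Tendsto u l (𝓝 (-b)))
    (hb : Tendsto (fun i => B (p i)) l (𝓝 b)) : -B x ∈ A x := by
  -- Cocoercivity bounds `β ‖B (p i) - B x‖²` by a pairing of a weakly null with a strongly
  -- convergent family, which tends to `0`.
  have hBx : B x = b := by
    have h1 : Tendsto (fun i => inner ℝ (p i - x) (B (p i) - B x)) l (𝓝 0) := by
      have hd := hb.sub_const (B x)
      have := (tendsto_inner_of_weak_of_strong hpR hp hd).sub (hd.inner (tendsto_const_nhds (x := x)))
      rw [real_inner_comm, sub_self] at this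
      refine this.congr fun i => ?_
      rw [inner_sub_left (p i) x, real_inner_comm x (B (p i) - B x)]
    have h2 : Tendsto (fun i => β * ‖B (p i) - B x‖ ^ 2) l (𝓝 (β * ‖b - B x‖ ^ 2)) :=
      ((hb.sub_const (B x)).norm.pow 2).const_mul β
    have h3 := le_of_tendsto_of_tendsto' h2 h1 fun i => hB (p i) x
    have h4 : ‖b - B x‖ ^ 2 ≤ 0 := by
      by_contra! h
      exact absurd h3 (not_le.2 (mul_pos hβ h))
    have h5 : ‖b - B x‖ = 0 := pow_eq_zero_iff two_ne_zero |>.1 (le_antisymm h4 (sq_nonneg _))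
    exact (sub_eq_zero.1 (norm_eq_zero.1 h5)).symm
  rw [hBx]
  refine hA.2 x (-b) fun y v hv => ?_
  have hd := hub.sub_const v
  have h1 := (tendsto_inner_of_weak_of_strong hwR hw hd).sub (hd.inner (tendsto_const_nhds (x := y)))
  rw [real_inner_comm y, ← inner_sub_left] at h1
  refine ge_of_tendsto' h1 fun i => ?_
  have := hA.1 (w i) y _ _ (hu i) hv
  rw [real_inner_comm y, ← inner_sub_left]
  simpa using this

/-- Weak limit points along which the variable-metric distances to each other converge coincide. -/
theorem weak_limit_unique {M : ℕ → H →L[ℝ] H} (hM : ∀ k, (M k).IsPositive) {σ : ℝ} (hσ : 0 < σ)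
    (hMσ : ∀ k x, σ * ‖x‖ ^ 2 ≤ inner ℝ (M k x) x)
    (hlim : ∀ x, ∃ y, Tendsto (M · x) atTop (𝓝 y)) {z : ℕ → H} {R : ℝ} (hR : ∀ k, ‖z k‖ ≤ R)
    {x y : H} {a b : ℝ} (hx : Tendsto (fun k => metricNorm (M k) (z k - x)) atTop (𝓝 a))
    (hy : Tendsto (fun k => metricNorm (M k) (z k - y)) atTop (𝓝 b)) {U V : Filter ℕ}
    [U.NeBot] [V.NeBot] (hU : U ≤ atTop) (hV : V ≤ atTop)
    (hUx : ∀ h, Tendsto (fun k => inner ℝ (z k) h) U (𝓝 (inner ℝ x h)))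
    (hVy : ∀ h, Tendsto (fun k => inner ℝ (z k) h) V (𝓝 (inner ℝ y h))) : x = y := by
  obtain ⟨Mx, hMx⟩ := hlim x
  obtain ⟨My, hMy⟩ := hlim y
  have hd : Tendsto (fun k => M k (x - y)) atTop (𝓝 (Mx - My)) := by
    simpa using hMx.sub hMy
  -- Polarization: `‖z - y‖_M² - ‖z - x‖_M² = 2⟪z, M (x - y)⟫ + ⟪M y, y⟫ - ⟪M x, x⟫`. The limit of
  -- the pairing, computed along `U` and along `V`, forces `⟪x - y, Mx - My⟫ = 0`.
  obtain ⟨c, hc⟩ : ∃ c, Tendsto (fun k => (inner ℝ (z k) (M k (x - y)) : ℝ)) atTop (𝓝 c) := by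
    have hxx : Tendsto (fun k => inner ℝ (M k x) x) atTop _ := hMx.inner tendsto_const_nhds
    have hyy : Tendsto (fun k => inner ℝ (M k y) y) atTop _ := hMy.inner tendsto_const_nhds
    refine ⟨_, (((((hy.pow 2).sub (hx.pow 2)).add hxx).sub hyy).div_const 2).congr fun k => ?_⟩
    rw [metricNorm_sq (hM k), metricNorm_sq (hM k)]
    simp only [map_sub, inner_sub_left, inner_sub_right, inner_apply_comm (hM k) x (z k),
      inner_apply_comm (hM k) y (z k)]
    rw [← inner_apply_comm (hM k) x (z k), ← inner_apply_comm (hM k) y (z k),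
      real_inner_comm (M k x), real_inner_comm (M k y)]
    ring
  have h1 := tendsto_nhds_unique (hc.mono_left hU)
    (tendsto_inner_of_weak_of_strong hR hUx (hd.mono_left hU))
  have h2 := tendsto_nhds_unique (hc.mono_left hV)
    (tendsto_inner_of_weak_of_strong hR hVy (hd.mono_left hV))
  have h3 : inner ℝ (Mx - My) (x - y) = 0 := by
    rw [real_inner_comm, inner_sub_left, ← h1, ← h2, sub_self]
  have h4 := ge_of_tendsto' (hd.inner (𝕜 := ℝ) (tendsto_const_nhds (x := x - y))) fun k => hMσ k (x - y)
  rw [h3] at h4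
  have h5 : ‖x - y‖ ^ 2 ≤ 0 := by
    by_contra! h
    exact absurd h4 (not_le.2 (mul_pos hσ h))
  have h6 : ‖x - y‖ = 0 := pow_eq_zero_iff two_ne_zero |>.1 (le_antisymm h5 (sq_nonneg _))
  exact sub_eq_zero.1 (norm_eq_zero.1 h6)

end Step

/-! ### Quasi-Fejér monotonicity of the inertial iteration. -/

section Iteration

variable {H : Type*} [NormedAddCommGroup H] [InnerProductSpace ℝ H]

theorem inertialTerm_nonneg (M : ℕ → H →L[ℝ] H) {α : ℕ → ℝ} (zinit : H) (z : ℕ → H) {k : ℕ}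
    (hα : 0 ≤ α k) : 0 ≤ inertialTerm M α zinit z k :=
  mul_nonneg hα (le_max_of_le_left (metricNorm_nonneg _ _))

theorem metricNorm_smul_le_inertialTerm (M : ℕ → H →L[ℝ] H) {α : ℕ → ℝ} (zinit : H) (z : ℕ → H)
    {k : ℕ} (hα : 0 ≤ α k) :
    metricNorm (M k) (α k • (z k - prev zinit z k)) ≤ inertialTerm M α zinit z k := by
  rw [metricNorm_smul hα]
  exact mul_le_mul_of_nonneg_left (le_max_left _ _) hα

theorem metricNorm_extrapolate_sub_le {M : ℕ → H →L[ℝ] H} {α : ℕ → ℝ} (zinit : H) (z : ℕ → H)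
    {k : ℕ} (hM : (M k).IsPositive) (hα : 0 ≤ α k) (x : H) :
    metricNorm (M k) (extrapolate α zinit z k - x) ≤
      metricNorm (M k) (z k - x) + inertialTerm M α zinit z k := by
  have h : extrapolate α zinit z k - x = (z k - x) + α k • (z k - prev zinit z k) := by
    rw [extrapolate]; abel
  rw [h]
  exact (metricNorm_add_le hM _ _).trans
    (add_le_add_right (metricNorm_smul_le_inertialTerm M zinit z hα) _)

/-- Expanding `(a + α d)²` leaves `2 a α d` and `α² d²`; the maximum of `d` and `d²` in the inertial
term absorbs both. -/
theorem metricNorm_extrapolate_sub_sq_le {M : ℕ → H →L[ℝ] H} {α : ℕ → ℝ} (zinit : H) (z : ℕ → H)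
    {k : ℕ} (hM : (M k).IsPositive) (hα : 0 ≤ α k) {Λ : ℝ} (hΛ : α k ≤ Λ) {x : H} {R : ℝ}
    (hR : metricNorm (M k) (z k - x) ≤ R) :
    metricNorm (M k) (extrapolate α zinit z k - x) ^ 2 ≤
      metricNorm (M k) (z k - x) ^ 2 + (2 * R + Λ) * inertialTerm M α zinit z k := by
  have h : extrapolate α zinit z k - x = (z k - x) + α k • (z k - prev zinit z k) := by
    rw [extrapolate]; abel
  have h1 := metricNorm_add_le hM (z k - x) (α k • (z k - prev zinit z k))
  rw [← h, metricNorm_smul hα] at h1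
  have ha := metricNorm_nonneg (M k) (z k - x)
  have hd := metricNorm_nonneg (M k) (z k - prev zinit z k)
  set d := metricNorm (M k) (z k - prev zinit z k)
  set a := metricNorm (M k) (z k - x)
  have h2 := pow_le_pow_left₀ (metricNorm_nonneg _ _) h1 2
  have h3 : α k * d ≤ inertialTerm M α zinit z k :=
    mul_le_mul_of_nonneg_left (le_max_left _ _) hα
  have h4 : α k * d ^ 2 ≤ inertialTerm M α zinit z k :=
    mul_le_mul_of_nonneg_left (le_max_right _ _) hα
  have h5 : a * (α k * d) ≤ R * inertialTerm M α zinit z k :=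
    mul_le_mul hR h3 (mul_nonneg hα hd) (ha.trans hR)
  have h6 : α k * (α k * d ^ 2) ≤ Λ * inertialTerm M α zinit z k :=
    mul_le_mul hΛ h4 (by positivity) (hα.trans hΛ)
  nlinarith

/-- Convergence of the variable-metric distances to a zero of `A + B`, together with the vanishing
of the residuals. -/
theorem fejer_convergence {A : H → Set H} {B : H → H} {β : ℝ} (hβ : 0 < β)
    (hA : StronglyMonotone 0 A) (hB : Cocoercive β B) {M : ℕ → H →L[ℝ] H}
    (hM : ∀ k, (M k).IsPositive) {C : ℝ} (hC : ∀ k, ‖M k‖ ≤ C) {η : ℕ → ℝ} (hη : ∀ k, 0 ≤ η k)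
    (hηs : Summable η) (hle : ∀ k, M (k + 1) ≤ (1 + η k) • M k) {ε : ℝ} (hε : 0 < ε)
    (hMε : ∀ k x, (1 / (2 * β) + ε) * ‖x‖ ^ 2 ≤ inner ℝ (M k x) x) {err : ℕ → H}
    (herr : Summable fun k => ‖err k‖) {α : ℕ → ℝ} (hα : ∀ k, 0 ≤ α k) {zinit : H} {z w : ℕ → H}
    (hw : ∀ k, M k (extrapolate α zinit z k - w k) - B (extrapolate α zinit z k) ∈ A (w k))
    (hz : ∀ k, z (k + 1) = w k + err k) (hsum : Summable (inertialTerm M α zinit z)) {x : H}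
    (hx : -B x ∈ A x) :
    (∃ l, Tendsto (fun k => metricNorm (M k) (z k - x)) atTop (𝓝 l)) ∧
    Tendsto (fun k => ‖extrapolate α zinit z k - w k‖) atTop (𝓝 0) ∧
    Tendsto (fun k => B (extrapolate α zinit z k)) atTop (𝓝 (B x)) := by
  set p := extrapolate α zinit z with hp
  set t := inertialTerm M α zinit z with ht
  have ht0 : ∀ k, 0 ≤ t k := fun k => inertialTerm_nonneg M zinit z (hα k)
  have hstep := fun k => step_le_of_half hβ hA hB (hM k) (hMε k) (hw k) hx
  have hwp : ∀ k, metricNorm (M k) (w k - x) ≤ metricNorm (M k) (p k - x) := fun k => by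
    refine Real.sqrt_le_sqrt (le_trans ?_ (hstep k))
    rw [add_assoc]
    exact le_add_of_nonneg_right (by positivity)
  have hpa : ∀ k, metricNorm (M k) (p k - x) ≤ metricNorm (M k) (z k - x) + t k := fun k =>
    metricNorm_extrapolate_sub_le zinit z (hM k) (hα k) x
  have hzw : ∀ k, metricNorm (M (k + 1)) (z (k + 1) - x) ≤
      (1 + η k) * (metricNorm (M k) (w k - x) + √C * ‖err k‖) := fun k => by
    refine (metricNorm_le_one_add_mul (hM k) (hη k) (hle k) _).trans ?_
    refine mul_le_mul_of_nonneg_left ?_ (by linarith [hη k])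
    rw [hz k, add_sub_right_comm]
    exact (metricNorm_add_le (hM k) _ _).trans (add_le_add_right (metricNorm_le (hC k) _) _)
  have hη1 : ∀ k, η k ≤ ∑' i, η i := fun k => hηs.le_tsum k fun i _ => hη i
  have hδ : Summable fun k => (1 + ∑' i, η i) * (t k + √C * ‖err k‖) :=
    (hsum.add (herr.mul_left _)).mul_left _
  have hη10 : 0 ≤ 1 + ∑' i, η i := by linarith [hη 0, hη1 0]
  have hconv : ∃ l, Tendsto (fun k => metricNorm (M k) (z k - x)) atTop (𝓝 l) := by
    refine exists_tendsto_of_le_one_add_mul_add (fun k => metricNorm_nonneg _ _) hη hηs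
      (fun k => ?_) hδ fun k => ?_
    · have := ht0 k
      positivity
    · have h1 : metricNorm (M k) (w k - x) + √C * ‖err k‖ ≤
          metricNorm (M k) (z k - x) + (t k + √C * ‖err k‖) := by
        linarith [hwp k, hpa k]
      have h2 := mul_le_mul_of_nonneg_left h1 (by linarith [hη k] : 0 ≤ 1 + η k)
      have h3 : (1 + η k) * (t k + √C * ‖err k‖) ≤ (1 + ∑' i, η i) * (t k + √C * ‖err k‖) := by
        have := ht0 k
        exact mul_le_mul_of_nonneg_right (by linarith [hη1 k]) (by positivity)
      linarith [hzw k]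
  obtain ⟨l, hl⟩ := hconv
  have ht_lim : Tendsto t atTop (𝓝 0) := hsum.tendsto_atTop_zero
  have hη_lim : Tendsto η atTop (𝓝 0) := hηs.tendsto_atTop_zero
  have hupper : Tendsto (fun k => metricNorm (M k) (z k - x) + t k) atTop (𝓝 l) := by
    simpa using hl.add ht_lim
  -- Solving the bound on `z (k + 1)` for the distance of `w k` bounds the latter from below by a
  -- sequence with limit `l`, so the distances of `w k` and `p k` are squeezed to `l` as well.
  have hlower : Tendsto (fun k => metricNorm (M (k + 1)) (z (k + 1) - x) / (1 + η k) -
      √C * ‖err k‖) atTop (𝓝 l) := by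
    have h1 := (hl.comp (tendsto_add_atTop_nat 1)).div (hη_lim.const_add 1) (by simp)
    simpa using h1.sub (herr.tendsto_atTop_zero.const_mul √C)
  have hlow : ∀ k, metricNorm (M (k + 1)) (z (k + 1) - x) / (1 + η k) - √C * ‖err k‖ ≤
      metricNorm (M k) (w k - x) := fun k => by
    rw [sub_le_iff_le_add, div_le_iff₀ (by linarith [hη k]), mul_comm]
    exact hzw k
  have hwl : Tendsto (fun k => metricNorm (M k) (w k - x)) atTop (𝓝 l) :=
    tendsto_of_tendsto_of_tendsto_of_le_of_le hlower hupper hlow fun k => (hwp k).trans (hpa k)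
  have hpl : Tendsto (fun k => metricNorm (M k) (p k - x)) atTop (𝓝 l) :=
    tendsto_of_tendsto_of_tendsto_of_le_of_le hwl hupper hwp hpa
  have hgap : Tendsto (fun k => metricNorm (M k) (p k - x) ^ 2 -
      metricNorm (M k) (w k - x) ^ 2) atTop (𝓝 0) := by
    simpa using (hpl.pow 2).sub (hwl.pow 2)
  have hstep' : ∀ k, ε * ‖p k - w k‖ ^ 2 +
      2 * β * (‖B (p k) - B x‖ - ‖p k - w k‖ / (2 * β)) ^ 2 ≤
      metricNorm (M k) (p k - x) ^ 2 - metricNorm (M k) (w k - x) ^ 2 := fun k => by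
    rw [metricNorm_sq (hM k), metricNorm_sq (hM k)]
    linarith [hstep k]
  have hsq : ∀ {f : ℕ → ℝ} {c : ℝ}, 0 < c → (∀ k, c * f k ^ 2 ≤ metricNorm (M k) (p k - x) ^ 2 -
      metricNorm (M k) (w k - x) ^ 2) → Tendsto f atTop (𝓝 0) := by
    intro f c hc hf
    have h1 : Tendsto (fun k => f k ^ 2) atTop (𝓝 0) := by
      refine squeeze_zero (fun k => sq_nonneg _) (fun k => ?_) (by simpa using hgap.div_const c)
      rw [le_div_iff₀ hc, mul_comm]
      exact hf k
    have h2 := h1.sqrt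
    simp only [Real.sqrt_sq_eq_abs, Real.sqrt_zero] at h2
    exact (tendsto_zero_iff_abs_tendsto_zero f).2 h2
  have he : Tendsto (fun k => ‖p k - w k‖) atTop (𝓝 0) :=
    hsq hε fun k => le_trans (le_add_of_nonneg_right (by positivity)) (hstep' k)
  have hd : Tendsto (fun k => ‖B (p k) - B x‖ - ‖p k - w k‖ / (2 * β)) atTop (𝓝 0) :=
    hsq (by positivity : 0 < 2 * β) fun k =>
      le_trans (le_add_of_nonneg_left (by positivity)) (hstep' k)
  refine ⟨⟨l, hl⟩, he, tendsto_iff_norm_sub_tendsto_zero.2 ?_⟩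
  simpa using hd.add (he.div_const (2 * β))

theorem norm_le_of_metricNorm_sub_le {M : H →L[ℝ] H} {σ : ℝ} (hσ : 0 < σ)
    (h : ∀ x, σ * ‖x‖ ^ 2 ≤ inner ℝ (M x) x) {y x : H} {R : ℝ} (hR : metricNorm M (y - x) ≤ R) :
    ‖y‖ ≤ R / √σ + ‖x‖ := by
  have h1 : ‖y - x‖ ≤ R / √σ := by
    rw [le_div_iff₀ (Real.sqrt_pos.2 hσ), mul_comm]
    exact (sqrt_mul_norm_le_metricNorm hσ.le h _).trans hR
  have h2 : ‖y‖ ≤ ‖y - x‖ + ‖x‖ := by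
    simpa using norm_add_le (y - x) x
  linarith

end Iteration

/-! ### Boundedness and weak convergence. -/

section Convergence

variable {H : Type*} [NormedAddCommGroup H] [InnerProductSpace ℝ H] [CompleteSpace H]

/-- Boundedness and weak convergence of the inertial iteration. -/
theorem bounded_and_weak_convergence {A : H → Set H} {B : H → H} {β : ℝ} (hβ : 0 < β)
    (hA : MaximallyMonotone A) (hB : Cocoercive β B) {M : ℕ → H →L[ℝ] H}
    (hM : ∀ k, (M k).IsPositive) {C : ℝ} (hC : ∀ k, ‖M k‖ ≤ C) {η : ℕ → ℝ} (hη : ∀ k, 0 ≤ η k)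
    (hηs : Summable η) (hle : ∀ k, M (k + 1) ≤ (1 + η k) • M k) {σ : ℝ} (hσ : 0 < σ)
    (hMσ : ∀ k x, σ * ‖x‖ ^ 2 ≤ inner ℝ (M k x) x) {ε : ℝ} (hε : 0 < ε)
    (hMε : ∀ k x, (1 / (2 * β) + ε) * ‖x‖ ^ 2 ≤ inner ℝ (M k x) x) {err : ℕ → H}
    (herr : Summable fun k => ‖err k‖) {α : ℕ → ℝ} (hα : ∀ k, 0 ≤ α k) {zinit : H} {z w : ℕ → H}
    (hw : ∀ k, M k (extrapolate α zinit z k - w k) - B (extrapolate α zinit z k) ∈ A (w k))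
    (hz : ∀ k, z (k + 1) = w k + err k) (hsum : Summable (inertialTerm M α zinit z)) {x : H}
    (hx : -B x ∈ A x) :
    Bornology.IsBounded (Set.range z) ∧ ∃ y, -B y ∈ A y ∧
      Tendsto (fun k => toWeakSpace ℝ H (z k)) atTop (𝓝 (toWeakSpace ℝ H y)) := by
  -- Kept for an arbitrary zero: it is applied to the given `x` and later to the weak cluster
  -- points.
  have hF := fun {y : H} (hy : -B y ∈ A y) =>
    fejer_convergence hβ hA.1 hB hM hC hη hηs hle hε hMε herr hα hw hz hsum hy
  obtain ⟨⟨l, hl⟩, he, hBp⟩ := hF hx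
  set p := extrapolate α zinit z with hp
  obtain ⟨R, hR⟩ := hl.bddAbove_range
  have hzb : ∀ k, ‖z k‖ ≤ R / √σ + ‖x‖ := fun k =>
    norm_le_of_metricNorm_sub_le hσ (hMσ k) (hR ⟨k, rfl⟩)
  have hpz : Tendsto (fun k => p k - z k) atTop (𝓝 0) := by
    refine squeeze_zero_norm (a := fun k => inertialTerm M α zinit z k / √σ) (fun k => ?_)
      (by simpa using hsum.tendsto_atTop_zero.div_const √σ)
    rw [le_div_iff₀ (Real.sqrt_pos.2 hσ), mul_comm]
    refine (sqrt_mul_norm_le_metricNorm hσ.le (hMσ k) _).trans ?_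
    rw [hp, extrapolate, add_sub_cancel_left]
    exact metricNorm_smul_le_inertialTerm M zinit z (hα k)
  have hwp : Tendsto (fun k => w k - p k) atTop (𝓝 0) := by
    rw [tendsto_zero_iff_norm_tendsto_zero]
    simpa only [norm_sub_rev] using he
  have hpb : ∃ R', ∀ k, ‖p k‖ ≤ R' := by
    obtain ⟨R', hR'⟩ := hpz.norm.bddAbove_range
    refine ⟨R' + (R / √σ + ‖x‖), fun k => ?_⟩
    have h1 := hR' ⟨k, rfl⟩
    have h2 := norm_add_le (p k - z k) (z k)
    rw [sub_add_cancel] at h2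
    exact h2.trans (add_le_add h1 (hzb k))
  obtain ⟨Rp, hRp⟩ := hpb
  have hwb : ∃ R', ∀ k, ‖w k‖ ≤ R' := by
    obtain ⟨R', hR'⟩ := hwp.norm.bddAbove_range
    refine ⟨R' + Rp, fun k => ?_⟩
    have h1 := hR' ⟨k, rfl⟩
    have h2 := norm_add_le (w k - p k) (p k)
    rw [sub_add_cancel] at h2
    exact h2.trans (add_le_add h1 (hRp k))
  obtain ⟨Rw, hRw⟩ := hwb
  have hres : Tendsto (fun k => M k (p k - w k) - B (p k)) atTop (𝓝 (-B x)) := by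
    have h1 : Tendsto (fun k => M k (p k - w k)) atTop (𝓝 0) :=
      squeeze_zero_norm (fun k => (M k).le_of_opNorm_le (hC k) _) (by simpa using he.const_mul C)
    simpa using h1.sub hBp
  have hcluster : ∀ (U : Ultrafilter ℕ), ↑U ≤ (atTop : Filter ℕ) → ∃ y, -B y ∈ A y ∧
      ∀ h, Tendsto (fun k => inner ℝ (z k) h) U (𝓝 (inner ℝ y h)) := by
    intro U hU
    obtain ⟨y, hy⟩ := exists_weak_limit U hzb
    have hpy := weak_limit_of_tendsto_sub hy (hpz.mono_left hU)
    have hwy := weak_limit_of_tendsto_sub hpy (hwp.mono_left hU)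
    exact ⟨y, mem_zer_of_weak_limit hβ hA hB (fun k => (hRw k).trans (le_max_left Rw Rp))
      (fun k => (hRp k).trans (le_max_right Rw Rp)) hwy hpy hw (hres.mono_left hU)
      (hBp.mono_left hU), hy⟩
  have hMlim := exists_tendsto_apply hM hC hη hηs hle
  -- One ultrafilter supplies the candidate; every other one finer than `atTop` must then give the
  -- same limit.
  obtain ⟨y, hyz, hy⟩ := hcluster (Ultrafilter.of atTop) (Ultrafilter.of_le _)
  refine ⟨?_, y, hyz, tendsto_toWeakSpace fun h => (tendsto_iff_ultrafilter _ _ _).2 fun U hU => ?_⟩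
  · refine isBounded_iff_forall_norm_le.2 ⟨R / √σ + ‖x‖, ?_⟩
    rintro _ ⟨k, rfl⟩
    exact hzb k
  · obtain ⟨y', hyz', hy'⟩ := hcluster U hU
    obtain ⟨⟨a, ha⟩, -⟩ := hF hyz
    obtain ⟨⟨b, hb⟩, -⟩ := hF hyz'
    have : y = y' := weak_limit_unique hM hσ hMσ hMlim hzb ha hb (Ultrafilter.of_le _) hU hy hy'
    rw [this]
    exact hy' h

end Convergence

/-! ### Linear rate under strong monotonicity. -/

section Rate

variable {H : Type*} [NormedAddCommGroup H] [InnerProductSpace ℝ H]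

/-- Linear convergence up to the inertial perturbation in the strongly monotone case. -/
theorem exists_linear_rate {A : H → Set H} {B : H → H} {β γA γB : ℝ} (hβ : 0 < β)
    (hγA : 0 ≤ γA) (hγB : 0 ≤ γB) (hγ : 0 < γA ∨ 0 < γB) (hA : StronglyMonotone γA A)
    (hB : Cocoercive β B) (hBm : StronglyMonotone γB (toSetValued B)) {M : ℕ → H →L[ℝ] H}
    (hM : ∀ k, (M k).IsPositive) {C : ℝ} (hC : ∀ k, ‖M k‖ ≤ C) {η : ℕ → ℝ} (hη : ∀ k, 0 ≤ η k)
    (hηs : Summable η) (hle : ∀ k, M (k + 1) ≤ (1 + η k) • M k)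
    (hMβ : ∀ k x, 1 / β * ‖x‖ ^ 2 ≤ inner ℝ (M k x) x) {α : ℕ → ℝ} {Λ : ℝ}
    (hα : ∀ k, 0 < α k ∧ α k ≤ Λ) {zinit : H} {z : ℕ → H}
    (hz : ∀ k, M k (extrapolate α zinit z k - z (k + 1)) - B (extrapolate α zinit z k) ∈
      A (z (k + 1))) {x : H} (hx : -B x ∈ A x) {R : ℝ}
    (hR : ∀ k, metricNorm (M k) (z k - x) ≤ R) :
    ∃ ξ Θ : ℝ, ∃ K₀ : ℕ, 0 < ξ ∧ ξ < 1 ∧ 0 < Θ ∧ ∀ k, K₀ ≤ k →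
      metricNorm (M k) (z k - x) ^ 2 ≤
        (1 - ξ) ^ (k - K₀) * metricNorm (M K₀) (z K₀ - x) ^ 2 +
        ∑ i ∈ Finset.Ico K₀ k, Θ * (1 - ξ) ^ (k - i) * inertialTerm M α zinit z i := by
  obtain ⟨q, hq0, hq1, hq⟩ := exists_step_contraction hβ hγA hγB hγ hA hB hBm C
  have hlim : Tendsto (fun k => (1 + η k) * q) atTop (𝓝 q) := by
    simpa using (hηs.tendsto_atTop_zero.const_add 1).mul_const q
  obtain ⟨K, hK⟩ := eventually_atTop.1
    (hlim.eventually_lt_const (by linarith : q < 1 - (1 - q) / 2))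
  have hR0 : 0 ≤ R := (metricNorm_nonneg _ _).trans (hR 0)
  have hΛ : 0 < Λ := (hα 0).1.trans_le (hα 0).2
  -- `ξ = (1 - q) / 2` places `1 - ξ` midway between `q` and `1`, above `(1 + η k) * q` for `k ≥ K`;
  -- `Θ` is the constant of the squared extrapolation bound.
  refine ⟨(1 - q) / 2, 2 * R + Λ, K, by linarith, by linarith, by linarith,
    le_pow_mul_add_sum (by linarith) fun k hk => ?_⟩
  have h1 := inner_apply_le_of_le (hle k) (z (k + 1) - x)
  rw [smul_apply, real_inner_smul_left] at h1
  have h2 := hq (M k) (hM k) (hC k) (hMβ k) _ _ _ (hz k) hx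
  have h3 := metricNorm_extrapolate_sub_sq_le zinit z (hM k) (hα k).1.le (hα k).2 (hR k)
  rw [metricNorm_sq (hM k)] at h3
  rw [metricNorm_sq (hM (k + 1))]
  have hη1 : 0 ≤ 1 + η k := by linarith [hη k]
  calc inner ℝ (M (k + 1) (z (k + 1) - x)) (z (k + 1) - x)
      ≤ (1 + η k) * (q * inner ℝ (M k (extrapolate α zinit z k - x))
          (extrapolate α zinit z k - x)) := h1.trans (mul_le_mul_of_nonneg_left h2 hη1)
    _ = (1 + η k) * q * inner ℝ (M k (extrapolate α zinit z k - x))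
          (extrapolate α zinit z k - x) := by ring
    _ ≤ _ := mul_le_mul (hK k hk).le h3 ((hM k).inner_nonneg_left _) (by linarith)

end Rate

end InertialFB

theorem theorem1 {H : Type*} [NormedAddCommGroup H] [InnerProductSpace ℝ H] [CompleteSpace H]
    (A : H → Set H) (B : H → H) (γA γB β : ℝ) (hγA : 0 ≤ γA) (hγB : 0 ≤ γB) (hβ : 0 < β)
    (hAmax : InertialFB.MaximallyMonotone A) (hA : InertialFB.StronglyMonotone γA A)
    (hBcoc : InertialFB.Cocoercive β B)
    (hB : InertialFB.StronglyMonotone γB (InertialFB.toSetValued B))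
    -- assumptions on the metrics and the errors
    (σ : ℝ) (hσ : 0 < σ) (M : ℕ → H →L[ℝ] H) (hM : ∀ k, M k ∈ InertialFB.selfAdjGE σ)
    (hMbdd : BddAbove (Set.range fun k => ‖M k‖))
    (hMmono : ∃ η : ℕ → ℝ, (∀ k, 0 ≤ η k) ∧ Summable η ∧ ∀ k, M (k + 1) ≤ (1 + η k) • M k)
    (hMβ : ∃ ε : ℝ, 0 < ε ∧
      ∀ k, M k - (1 / (2 * β)) • ContinuousLinearMap.id ℝ H ∈ InertialFB.selfAdjGE ε)
    (err : ℕ → H) (herr : Summable fun k => ‖err k‖)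
    -- the iteration and the inertial parameters
    (α : ℕ → ℝ) (Λ : ℝ) (hα : ∀ k, 0 < α k ∧ α k ≤ Λ)
    (zinit : H) (z : ℕ → H) (hz : InertialFB.IsInertialFB A B M α err zinit z)
    (hsum : Summable (InertialFB.inertialTerm M α zinit z))
    (hzer : (InertialFB.zer (InertialFB.opAdd A (InertialFB.toSetValued B))).Nonempty) :
    Bornology.IsBounded (Set.range z) ∧
    ∃ zs ∈ InertialFB.zer (InertialFB.opAdd A (InertialFB.toSetValued B)),
      Tendsto (fun k => toWeakSpace ℝ H (z k)) atTop (𝓝 (toWeakSpace ℝ H zs)) ∧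
      ((∀ k, err k = 0) → (0 < γA ∨ 0 < γB) →
        (∃ ε : ℝ, 0 < ε ∧
          ∀ k, M k - (1 / β) • ContinuousLinearMap.id ℝ H ∈ InertialFB.selfAdjGE ε) →
        ∃ ξ Θ : ℝ, ∃ K₀ : ℕ, 0 < ξ ∧ ξ < 1 ∧ 0 < Θ ∧ ∀ k, K₀ ≤ k →
          InertialFB.metricNorm (M k) (z k - zs) ^ 2 ≤
            (1 - ξ) ^ (k - K₀) * InertialFB.metricNorm (M K₀) (z K₀ - zs) ^ 2 +
            ∑ i ∈ Finset.Ico K₀ k,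
              Θ * (1 - ξ) ^ (k - i) * InertialFB.inertialTerm M α zinit z i) := by
  obtain ⟨η, hη, hηs, hle⟩ := hMmono
  obtain ⟨ε, hε, hMε⟩ := hMβ
  obtain ⟨C, hC⟩ := hMbdd
  have hC' : ∀ k, ‖M k‖ ≤ C := fun k => hC ⟨k, rfl⟩
  have hpos : ∀ k, (M k).IsPositive := fun k => InertialFB.isPositive_of_mem hσ.le (hM k)
  have hMσ : ∀ k x, σ * ‖x‖ ^ 2 ≤ inner ℝ (M k x) x := fun k =>
    InertialFB.le_inner_apply_of_mem (hM k)
  have hMε' : ∀ k x, (1 / (2 * β) + ε) * ‖x‖ ^ 2 ≤ inner ℝ (M k x) x := fun k =>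
    InertialFB.add_mul_le_inner_apply_of_sub_mem (hMε k)
  choose w hw hzw using hz
  have hw' := fun k =>
    InertialFB.sub_mem_of_mem_metricResolvent (InertialFB.isInvertible_of_mem hσ (hM k)) (hw k)
  obtain ⟨x, hx⟩ := hzer
  rw [InertialFB.mem_zer_opAdd] at hx
  obtain ⟨hbdd, zs, hzs, hlim⟩ := InertialFB.bounded_and_weak_convergence hβ hAmax hBcoc hpos hC'
    hη hηs hle hσ hMσ hε hMε' herr (fun k => (hα k).1.le) hw' hzw hsum hx
  refine ⟨hbdd, zs, InertialFB.mem_zer_opAdd.2 hzs, hlim, ?_⟩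
  rintro herr0 hγ ⟨ε', hε', hMε''⟩
  -- Convergence of the distances to `zs` itself supplies the uniform bound `R` that enters `Θ`.
  obtain ⟨⟨l, hl⟩, -⟩ := InertialFB.fejer_convergence hβ hAmax.1 hBcoc hpos hC' hη hηs hle hε hMε'
    herr (fun k => (hα k).1.le) hw' hzw hsum hzs
  obtain ⟨R, hR⟩ := hl.bddAbove_range
  refine InertialFB.exists_linear_rate hβ hγA hγB hγ hA hBcoc hB hpos hC' hη hηs hle
    (fun k y => ?_) hα (fun k => ?_) hzs fun k => hR ⟨k, rfl⟩
  · refine le_trans ?_ (InertialFB.add_mul_le_inner_apply_of_sub_mem (hMε'' k) y)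
    exact mul_le_mul_of_nonneg_right (by linarith) (sq_nonneg _)
  · rw [hzw k, herr0 k, add_zero]
    exact hw' k
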